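/- There is a universal constant $C>0$ such that the following holds. Let $\delta,\varepsilon\in(0,1)$ and $c>0$, let $f(x)=\left|\frac{\delta}{x}\right|^{c}$ for $x \neq 0$, and let $$D=\frac{\max(1,c)}{\delta}\,\log\frac{1}{\delta\varepsilon}.$$ Then there exist an even polynomial $p$ with real coefficients and $\deg p\le C D$, and an odd polynomial $q$ with real coefficients and $\deg q\le\max(1,\,C D)$, such that $$\max_{x\in[-1,1]}|p(x)|\le 3,\qquad \max_{x\in[\delta,1]}|p(x)-f(x)|\le\varepsilon,$$ $$\max_{x\in[-1,1]}|q(x)|\le 3,\qquad \max_{x\in[\delta,1]}|q(x)-f(x)|\le\varepsilon .$$ -/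

import Mathlib

open Polynomial Finset

/-! Put a = x², γ = c/2, m = max(1, c). The task is to approximate a^(-γ) on [δ², 1] by a polynomial
that stays controlled on [0, 1]. The incomplete Beta function I_a(γ + J, N + 1) is the distribution
function of a law concentrated near J/(J+N), and the substitution r = as shows that a^(-γ) I_a is a
polynomial in a of degree J + N. If J/(J+N) lies below δ² by a relative margin of order 1/m, this
polynomial is close to a^(-γ) for a ≥ δ² and bounded for smaller a
(`exists_polynomial_approx_rpow_neg`). Concentration within that margin takes J of order m²(1 +
log(1/ε)), so the degree is of order (m/δ)²(1 + log(1/ε)), which is too large.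

The degree is then cut down by complex analysis. On the Joukowski image of |u| = e^(-w) the
polynomial grows by at most cosh(2w)^(J+N) ≤ exp(2w²(J+N)). Since the exponent is quadratic in w,
taking w = δ/m leaves only exp(O(1 + log(1/ε))). Chebyshev coefficients decay like e^(-wk) against
this bound, so truncation at degree of order (m/δ)(1 + log(1/ε)) suffices
(`Polynomial.exists_natDegree_le_approx_of_joukowski_bound`).

The odd case multiplies the even approximant for c + 1 by x/δ. This amplifies the error by up to
1/δ, whence log(1/(δε)). -/

/-! ### Discrete Fourier analysis on a circle -/

theorem IsPrimitiveRoot.sum_pow_mul_inv_pow {ω : ℂ} {Q : ℕ} (hω : IsPrimitiveRoot ω Q)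
    {i j : ℕ} (hi : i < Q) (hj : j < Q) :
    ∑ t ∈ range Q, (ω ^ t) ^ i * ((ω ^ t)⁻¹) ^ j = if i = j then (Q : ℂ) else 0 := by
  have hω0 : ω ≠ 0 := hω.ne_zero (by omega)
  have e : ∀ t, (ω ^ t) ^ i * ((ω ^ t)⁻¹) ^ j = (ω ^ i * (ω ^ j)⁻¹) ^ t := by
    intro t
    rw [mul_pow, inv_pow, inv_pow, ← pow_mul, ← pow_mul, ← pow_mul, ← pow_mul, mul_comm t i,
      mul_comm t j]
  simp only [e]
  split_ifs with h
  · subst h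
    rw [mul_inv_cancel₀ (pow_ne_zero _ hω0)]
    simp
  · have hne : ω ^ i * (ω ^ j)⁻¹ ≠ 1 := by
      intro h1
      rw [mul_inv_eq_one₀ (pow_ne_zero _ hω0)] at h1
      exact h (hω.pow_inj hi hj h1)
    have h2 := mul_geom_sum (ω ^ i * (ω ^ j)⁻¹) Q
    have h3 : (ω ^ i * (ω ^ j)⁻¹) ^ Q = 1 := by
      rw [mul_pow, inv_pow, ← pow_mul, ← pow_mul, mul_comm i, mul_comm j, pow_mul, pow_mul,
        hω.pow_eq_one]
      simp
    rw [h3, sub_self] at h2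
    exact (mul_eq_zero.mp h2).resolve_left (sub_ne_zero.mpr hne)

/-- Discrete Parseval: exponents below Q do not alias, so the cross terms cancel. -/
theorem IsPrimitiveRoot.sum_norm_sq_geom {ω : ℂ} {Q : ℕ} (hω : IsPrimitiveRoot ω Q) (z : ℂ)
    {s : Finset ℕ} (hs : ∀ i ∈ s, i < Q) :
    ∑ t ∈ range Q, ‖∑ i ∈ s, (z * ω ^ t) ^ i‖ ^ 2 = Q * ∑ i ∈ s, (‖z‖ ^ 2) ^ i := by
  rcases Nat.eq_zero_or_pos Q with rfl | hQ
  · simp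
  have hn : ‖ω‖ = 1 := hω.norm'_eq_one hQ.ne'
  have hc : (starRingEnd ℂ) ω = ω⁻¹ := (Complex.inv_eq_conj hn).symm
  have key : ∀ t, ((‖∑ i ∈ s, (z * ω ^ t) ^ i‖ ^ 2 : ℝ) : ℂ) =
      ∑ i ∈ s, ∑ j ∈ s, z ^ i * (starRingEnd ℂ z) ^ j *
        ((ω ^ t) ^ i * ((ω ^ t)⁻¹) ^ j) := by
    intro t
    rw [Complex.ofReal_pow, ← Complex.mul_conj', map_sum, sum_mul_sum]
    refine sum_congr rfl fun i _ => sum_congr rfl fun j _ => ?_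
    simp only [map_pow, map_mul, hc, mul_pow, inv_pow]
    ring
  have : ((∑ t ∈ range Q, ‖∑ i ∈ s, (z * ω ^ t) ^ i‖ ^ 2 : ℝ) : ℂ) =
      ((Q * ∑ i ∈ s, (‖z‖ ^ 2) ^ i : ℝ) : ℂ) := by
    rw [Complex.ofReal_sum]
    simp only [key]
    rw [sum_comm]
    push_cast
    rw [mul_sum]
    refine sum_congr rfl fun i hi => ?_
    rw [sum_comm]
    simp only [← mul_sum]
    rw [sum_congr rfl fun j hj => by rw [hω.sum_pow_mul_inv_pow (hs i hi) (hs j hj)]]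
    simp only [mul_ite, mul_zero, sum_ite_eq, hi, if_true]
    rw [← mul_pow, Complex.mul_conj', mul_comm]
  exact_mod_cast this

/-- Multiplying by u^k and averaging isolates the coefficient of u^(-k). The positive powers u^(j+k)
average to zero because 0 < j + k < Q. -/
theorem IsPrimitiveRoot.coeff_of_sum_joukowski {ω : ℂ} {Q : ℕ} (hω : IsPrimitiveRoot ω Q)
    (b : ℕ → ℝ) {D k : ℕ} (hb : ∀ j, D < j → b j = 0) (hk : 1 ≤ k) (hQ : D + k < Q)
    {r : ℂ} (hr : r ≠ 0) :
    ∑ t ∈ range Q, (∑ j ∈ range (D + 1), (b j : ℂ) * (((r * ω ^ t) ^ j + (r * ω ^ t)⁻¹ ^ j) / 2)) *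
      (r * ω ^ t) ^ k = Q / 2 * b k := by
  have hω0 : ω ≠ 0 := hω.ne_zero (by omega)
  have e : ∀ t j, (b j : ℂ) * (((r * ω ^ t) ^ j + (r * ω ^ t)⁻¹ ^ j) / 2) * (r * ω ^ t) ^ k =
      (b j : ℂ) / 2 * r ^ (j + k) * ((ω ^ t) ^ (j + k) * (ω ^ t)⁻¹ ^ 0) +
      (b j : ℂ) / 2 * (r⁻¹ ^ j * r ^ k) * ((ω ^ t) ^ k * (ω ^ t)⁻¹ ^ j) := by
    intro t j
    simp only [mul_pow, mul_inv, pow_add, pow_zero]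
    ring
  simp only [sum_mul, e]
  rw [sum_comm]
  simp only [sum_add_distrib, ← mul_sum]
  have h1 : ∀ j ∈ range (D + 1),
      (b j : ℂ) / 2 * r ^ (j + k) * ∑ t ∈ range Q, (ω ^ t) ^ (j + k) * (ω ^ t)⁻¹ ^ 0 = 0 := by
    intro j hj
    rw [mem_range] at hj
    rw [hω.sum_pow_mul_inv_pow (by omega) (by omega), if_neg (by omega), mul_zero]
  have h2 : ∀ j ∈ range (D + 1),
      (b j : ℂ) / 2 * (r⁻¹ ^ j * r ^ k) * ∑ t ∈ range Q, (ω ^ t) ^ k * (ω ^ t)⁻¹ ^ j =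
        if k = j then Q / 2 * (b k : ℂ) else 0 := by
    intro j hj
    rw [mem_range] at hj
    rw [hω.sum_pow_mul_inv_pow (by omega) (by omega)]
    split_ifs with h
    · subst h
      rw [inv_pow, inv_mul_cancel₀ (pow_ne_zero _ hr)]
      ring
    · simp
  rw [sum_eq_zero h1, sum_congr rfl h2, sum_ite_eq, zero_add]
  split_ifs with h
  · rfl
  · rw [hb k (by simpa using h)]
    simp

/-! ### Chebyshev series and their truncation -/

theorem Polynomial.Chebyshev.exists_eq_sum_T (P : ℝ[X]) :
    ∃ (D : ℕ) (b : ℕ → ℝ), (∀ j, D < j → b j = 0) ∧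
      P = ∑ j ∈ range (D + 1), b j • Chebyshev.T ℝ j := by
  let S : Polynomial.Sequence ℝ :=
    { elems' := fun n => Chebyshev.T ℝ n
      degree_eq' := fun n => by simp }
  have hspan : Submodule.span ℝ (Set.range S) = ⊤ := S.span fun i => by
    refine isUnit_iff_ne_zero.mpr (leadingCoeff_ne_zero.mpr ?_)
    exact Chebyshev.T_ne_zero ℝ (i : ℤ)
  have hP : P ∈ Submodule.span ℝ (Set.range S) := hspan ▸ Submodule.mem_top
  obtain ⟨c, hc⟩ := (Finsupp.mem_span_range_iff_exists_finsupp).mp hP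
  have hsup : ∀ j, c.support.sup id < j → c j = 0 := by
    intro j hj
    by_contra h
    have := Finset.le_sup (f := id) (Finsupp.mem_support_iff.mpr h)
    simp only [id] at this
    exact absurd hj (not_lt.mpr this)
  refine ⟨c.support.sup id, c, hsup, ?_⟩
  rw [← hc]
  refine Finsupp.sum_of_support_subset _ ?_ _ (by simp)
  intro j hj
  rw [mem_range, Nat.lt_succ_iff]
  exact Finset.le_sup (f := id) hj

theorem Polynomial.Chebyshev.eval_T_joukowski {u : ℂ} (hu : u ≠ 0) (k : ℕ) :
    (Chebyshev.T ℂ k).eval ((u + u⁻¹) / 2) = (u ^ k + u⁻¹ ^ k) / 2 := by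
  obtain ⟨v, rfl⟩ : ∃ v, Complex.exp v = u := ⟨_, Complex.exp_log hu⟩
  rw [← Complex.exp_neg, ← Complex.exp_nat_mul, ← Complex.exp_nat_mul]
  have := Chebyshev.T_complex_cosh v k
  rw [Complex.cosh, Complex.cosh] at this
  rw [this]
  push_cast
  ring_nf

/-- If `P` is bounded by `M` on the image of the circle of radius `r < 1` under the Joukowski map,
then it has a good approximation of degree at most `2 * n` on `[-1, 1]`; this de la Vallée-Poussin
mean does not lose a factor `(1 - r)⁻¹` when `n * (1 - r)` is of order one. -/
theorem Polynomial.exists_natDegree_le_approx_of_joukowski_bound (P : ℝ[X]) {r M : ℝ}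
    (hr0 : 0 < r) (hr1 : r < 1) (hM : 0 ≤ M)
    (hP : ∀ u : ℂ, ‖u‖ = r → ‖aeval ((u + u⁻¹) / 2) P‖ ≤ M) {n : ℕ} (hn : 1 ≤ n) :
    ∃ q : ℝ[X], q.natDegree ≤ 2 * n ∧
      ∀ x ∈ Set.Icc (-1 : ℝ) 1, |P.eval x - q.eval x| ≤ 2 * M * r ^ n / (n * (1 - r ^ 2)) := by
  obtain ⟨D, b, hb, hPb⟩ := Chebyshev.exists_eq_sum_T P
  have hn0 : (0 : ℝ) < n := by exact_mod_cast hn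
  let q : ℝ[X] := (n : ℝ)⁻¹ • ∑ l ∈ Ioc n (2 * n), ∑ k ∈ range l, b k • Chebyshev.T ℝ k
  refine ⟨q, ?_, ?_⟩
  · refine (natDegree_smul_le _ _).trans ?_
    refine natDegree_sum_le_of_forall_le _ _ fun l hl => ?_
    refine natDegree_sum_le_of_forall_le _ _ fun k hk => ?_
    refine (natDegree_smul_le _ _).trans ?_
    rw [Chebyshev.natDegree_T]
    simp only [mem_Ioc, mem_range] at hl hk
    simp only [Int.natAbs_natCast]
    omega
  intro x hx
  obtain ⟨θ, rfl⟩ : ∃ θ, Real.cos θ = x := ⟨_, Real.cos_arccos hx.1 hx.2⟩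
  set e : ℂ := Complex.exp (θ * Complex.I) with he
  have hen : ‖e‖ = 1 := Complex.norm_exp_ofReal_mul_I θ
  have hTe : ∀ k : ℕ, (Chebyshev.T ℝ k).eval (Real.cos θ) = (e ^ k).re := by
    intro k
    rw [Chebyshev.T_real_cos, he, ← Complex.exp_nat_mul, ← mul_assoc]
    have := Complex.exp_ofReal_mul_I_re (k * θ)
    push_cast at this ⊢
    rw [this]
  have hdiff : P.eval (Real.cos θ) - q.eval (Real.cos θ) =
      (n : ℝ)⁻¹ * (∑ l ∈ Ioc n (2 * n), ∑ i ∈ range (D + 1), (b (l + i) : ℂ) * e ^ (l + i)).re := by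
    -- Padding with zero coefficients gives every tail the same length D + 1, so that the double sum
    -- over l and i later factors as a product.
    have h1 : ∀ l, P.eval (Real.cos θ) = (∑ k ∈ range l, b k • Chebyshev.T ℝ k).eval (Real.cos θ) +
        ∑ i ∈ range (D + 1), b (l + i) * (e ^ (l + i)).re := by
      intro l
      have h2 : P = ∑ j ∈ range (l + (D + 1)), b j • Chebyshev.T ℝ j := by
        rw [hPb]
        refine sum_subset (range_subset_range.mpr (by omega)) fun j _ hj => ?_
        rw [hb j (by simpa using hj), zero_smul]
      rw [h2, sum_range_add, eval_add]
      congr 1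
      rw [eval_finsetSum]
      refine sum_congr rfl fun i _ => ?_
      rw [eval_smul, smul_eq_mul, hTe]
    have h3 : (n : ℝ) * P.eval (Real.cos θ) = ∑ l ∈ Ioc n (2 * n), P.eval (Real.cos θ) := by
      rw [sum_const, Nat.card_Ioc, nsmul_eq_mul]
      congr 2
      omega
    have h4 : P.eval (Real.cos θ) = (n : ℝ)⁻¹ * ∑ l ∈ Ioc n (2 * n), P.eval (Real.cos θ) := by
      rw [← h3, inv_mul_cancel_left₀ hn0.ne']
    rw [h4, sum_congr rfl fun l _ => h1 l, sum_add_distrib, mul_add]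
    simp only [q, eval_smul, smul_eq_mul, eval_finsetSum, Complex.re_sum, Complex.re_ofReal_mul]
    ring
  -- Frequencies go up to k = l + i ≤ 2n + D, and extracting b k requires D + k < Q.
  set Q : ℕ := 2 * D + 2 * n + 1 with hQ
  have hQ0 : (0 : ℝ) < Q := by rw [hQ]; positivity
  obtain ⟨ω, hω⟩ : ∃ ω : ℂ, IsPrimitiveRoot ω Q :=
    ⟨_, Complex.isPrimitiveRoot_exp Q (by omega)⟩
  have hωn : ‖ω‖ = 1 := hω.norm'_eq_one (by omega)
  have hrC : (r : ℂ) ≠ 0 := by exact_mod_cast hr0.ne'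
  have hvn : ∀ t : ℕ, ‖(r : ℂ) * ω ^ t‖ = r := by
    intro t
    rw [norm_mul, norm_pow, hωn, one_pow, mul_one, Complex.norm_real, Real.norm_of_nonneg hr0.le]
  let H : ℂ → ℂ := fun u => aeval ((u + u⁻¹) / 2) P
  have hH : ∀ u : ℂ, u ≠ 0 →
      H u = ∑ j ∈ range (D + 1), (b j : ℂ) * ((u ^ j + u⁻¹ ^ j) / 2) := by
    intro u hu
    simp only [H]
    rw [hPb, map_sum]
    refine sum_congr rfl fun j _ => ?_
    rw [map_smul, Chebyshev.aeval_T, Chebyshev.eval_T_joukowski hu]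
    simp
  let A : ℕ → ℂ := fun t => ∑ i ∈ range (D + 1), (e * r * ω ^ t) ^ i
  let B : ℕ → ℂ := fun t => ∑ l ∈ Ioc n (2 * n), (e * r * ω ^ t) ^ l
  have hsum : ∑ l ∈ Ioc n (2 * n), ∑ i ∈ range (D + 1), (b (l + i) : ℂ) * e ^ (l + i) =
      2 / Q * ∑ t ∈ range Q, H (r * ω ^ t) * (A t * B t) := by
    have hQC : (Q : ℂ) ≠ 0 := by exact_mod_cast hQ0.ne'
    have h1 : ∀ l ∈ Ioc n (2 * n), ∀ i ∈ range (D + 1), (b (l + i) : ℂ) * e ^ (l + i) =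
        2 / Q * ∑ t ∈ range Q, H (r * ω ^ t) *
          ((e * r * ω ^ t) ^ i * (e * r * ω ^ t) ^ l) := by
      intro l hl i hi
      simp only [mem_Ioc, mem_range] at hl hi
      have h2 := hω.coeff_of_sum_joukowski b hb (k := l + i) (by omega) (by omega) hrC
      have h3 : ∀ t ∈ range Q, H (r * ω ^ t) *
          ((e * r * ω ^ t) ^ i * (e * r * ω ^ t) ^ l) = e ^ (l + i) *
          ((∑ j ∈ range (D + 1),
            (b j : ℂ) * (((r * ω ^ t) ^ j + (r * ω ^ t)⁻¹ ^ j) / 2)) * (r * ω ^ t) ^ (l + i)) := by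
        intro t _
        rw [hH _ (by rw [← norm_pos_iff, hvn]; exact hr0)]
        rw [← pow_add, add_comm i l, mul_assoc e, mul_pow e]
        ring
      rw [sum_congr rfl h3, ← mul_sum, h2]
      field_simp
    rw [sum_congr rfl fun l hl => sum_congr rfl fun i hi => h1 l hl i hi]
    simp only [← mul_sum]
    congr 1
    rw [sum_congr rfl fun l hl => sum_comm, sum_comm]
    refine sum_congr rfl fun t _ => ?_
    simp only [← mul_sum]
    congr 1
    simp only [A, B]
    rw [sum_mul_sum, sum_comm]
  have hz : ‖e * r‖ = r := by
    rw [norm_mul, hen, one_mul, Complex.norm_real, Real.norm_of_nonneg hr0.le]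
  have hr2 : r ^ 2 < 1 := by nlinarith
  have hA : ∑ t ∈ range Q, ‖A t‖ ^ 2 ≤ Q * (1 / (1 - r ^ 2)) := by
    simp only [A]
    rw [hω.sum_norm_sq_geom (e * r) (fun i hi => by rw [mem_range] at hi; omega), hz]
    gcongr
    rw [one_div, ← tsum_geometric_of_lt_one (by positivity) hr2]
    exact (summable_geometric_of_lt_one (by positivity) hr2).sum_le_tsum _
      fun i _ => by positivity
  have hB : ∑ t ∈ range Q, ‖B t‖ ^ 2 ≤ Q * (r ^ (2 * n) * (1 / (1 - r ^ 2))) := by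
    simp only [B]
    rw [hω.sum_norm_sq_geom (e * r) (fun i hi => by rw [mem_Ioc] at hi; omega), hz]
    gcongr
    calc ∑ l ∈ Ioc n (2 * n), (r ^ 2) ^ l ≤ ∑ l ∈ Ico n (2 * n + 1), (r ^ 2) ^ l :=
          sum_le_sum_of_subset_of_nonneg
            (fun l hl => by simp only [mem_Ioc, mem_Ico] at hl ⊢; omega)
            fun _ _ _ => by positivity
      _ ≤ (r ^ 2) ^ n / (1 - r ^ 2) := geom_sum_Ico_le_of_lt_one (by positivity) hr2
      _ = r ^ (2 * n) * (1 / (1 - r ^ 2)) := by rw [← pow_mul, mul_one_div]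
  have hAB : ∑ t ∈ range Q, ‖A t‖ * ‖B t‖ ≤ Q * (r ^ n / (1 - r ^ 2)) := by
    -- Cauchy–Schwarz in weighted form: the mean square bound for B is r^(2n) times that for A, so
    -- the weight r^n balances the two terms.
    have h1 : ∀ t, 2 * (‖A t‖ * ‖B t‖) ≤ r ^ n * ‖A t‖ ^ 2 + (r ^ n)⁻¹ * ‖B t‖ ^ 2 := by
      intro t
      have hrn : 0 < r ^ n := by positivity
      have := mul_nonneg (inv_nonneg.mpr hrn.le) (sq_nonneg (r ^ n * ‖A t‖ - ‖B t‖))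
      have h2 : (r ^ n)⁻¹ * (r ^ n * ‖A t‖ - ‖B t‖) ^ 2 =
        r ^ n * ‖A t‖ ^ 2 + (r ^ n)⁻¹ * ‖B t‖ ^ 2 - 2 * (‖A t‖ * ‖B t‖) := by
        field_simp
        ring
      linarith
    have h2 := sum_le_sum fun t (_ : t ∈ range Q) => h1 t
    rw [← mul_sum, sum_add_distrib, ← mul_sum, ← mul_sum] at h2
    have h3 : r ^ n * ∑ t ∈ range Q, ‖A t‖ ^ 2 ≤ r ^ n * (Q * (1 / (1 - r ^ 2))) := by gcongr
    have h4 : (r ^ n)⁻¹ * ∑ t ∈ range Q, ‖B t‖ ^ 2 ≤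
        (r ^ n)⁻¹ * (Q * (r ^ (2 * n) * (1 / (1 - r ^ 2)))) := by gcongr
    have h5 : (r ^ n)⁻¹ * (Q * (r ^ (2 * n) * (1 / (1 - r ^ 2)))) =
        r ^ n * (Q * (1 / (1 - r ^ 2))) := by
      rw [mul_comm 2 n, pow_mul]
      field_simp
    have h6 : r ^ n * (Q * (1 / (1 - r ^ 2))) = Q * (r ^ n / (1 - r ^ 2)) := by ring
    linarith
  have hfin : ‖∑ l ∈ Ioc n (2 * n), ∑ i ∈ range (D + 1), (b (l + i) : ℂ) * e ^ (l + i)‖ ≤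
      2 / Q * (M * (Q * (r ^ n / (1 - r ^ 2)))) := by
    rw [hsum, norm_mul, norm_div, Complex.norm_natCast, Complex.norm_ofNat]
    gcongr
    refine (norm_sum_le _ _).trans ?_
    refine le_trans (sum_le_sum (g := fun t => M * (‖A t‖ * ‖B t‖)) fun t _ => ?_) ?_
    · rw [norm_mul, norm_mul]
      gcongr
      exact hP _ (hvn t)
    · rw [← mul_sum]
      gcongr
  rw [hdiff, abs_mul, abs_of_pos (inv_pos.mpr hn0)]
  calc (n : ℝ)⁻¹ * |(∑ l ∈ Ioc n (2 * n), ∑ i ∈ range (D + 1), (b (l + i) : ℂ) * e ^ (l + i)).re|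
      ≤ (n : ℝ)⁻¹ * (2 / Q * (M * (Q * (r ^ n / (1 - r ^ 2))))) := by
        gcongr
        exact (Complex.abs_re_le_norm _).trans hfin
    _ = 2 * M * r ^ n / (n * (1 - r ^ 2)) := by
        have : 1 - r ^ 2 ≠ 0 := by linarith
        field_simp

/-! ### Beta integrals and the incomplete Beta polynomial -/

theorem continuous_rpow_mul_one_sub_mul_pow {μ : ℝ} (hμ : 0 ≤ μ) (N : ℕ) (a : ℝ) :
    Continuous fun s : ℝ => s ^ μ * (1 - a * s) ^ N :=
  (Real.continuous_rpow_const hμ).mul (by fun_prop)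

theorem continuous_rpow_mul_one_sub_pow {μ : ℝ} (hμ : 0 ≤ μ) (N : ℕ) :
    Continuous fun s : ℝ => s ^ μ * (1 - s) ^ N :=
  (Real.continuous_rpow_const hμ).mul (by fun_prop)

theorem integral_rpow_mul_one_sub_pow_pos {μ : ℝ} (hμ : 0 ≤ μ) (N : ℕ) :
    0 < ∫ r in (0 : ℝ)..1, r ^ μ * (1 - r) ^ N := by
  refine intervalIntegral.intervalIntegral_pos_of_pos_on
    ((continuous_rpow_mul_one_sub_pow hμ N).intervalIntegrable _ _) (fun x hx => ?_) one_pos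
  have := hx.1
  have : 0 < 1 - x := by linarith [hx.2]
  positivity

/-- Integrate the derivative of r^(μ+1) (1-r)^(N+1), which vanishes at both ends. -/
theorem integral_rpow_add_one_mul_one_sub_pow {μ : ℝ} (hμ : 0 ≤ μ) (N : ℕ) :
    (μ + N + 2) * ∫ r in (0 : ℝ)..1, r ^ (μ + 1) * (1 - r) ^ N =
      (μ + 1) * ∫ r in (0 : ℝ)..1, r ^ μ * (1 - r) ^ N := by
  have hd : ∀ x ∈ Set.uIcc (0 : ℝ) 1,
      HasDerivAt (fun r : ℝ => r ^ (μ + 1) * (1 - r) ^ (N + 1))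
        ((μ + 1) * (x ^ μ * (1 - x) ^ N) - (μ + N + 2) * (x ^ (μ + 1) * (1 - x) ^ N)) x := by
    intro x hx
    rw [Set.uIcc_of_le zero_le_one] at hx
    have h1 : HasDerivAt (fun r : ℝ => r ^ (μ + 1)) ((μ + 1) * x ^ μ) x := by
      simpa using Real.hasDerivAt_rpow_const (x := x) (p := μ + 1) (Or.inr (by linarith))
    have h2 : HasDerivAt (fun r : ℝ => (1 - r) ^ (N + 1)) ((N + 1) * (1 - x) ^ N * (-1)) x := by
      simpa using ((hasDerivAt_id x).const_sub 1).fun_pow (N + 1)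
    refine (h1.fun_mul h2).congr_deriv ?_
    have h3 : x ^ (μ + 1) = x ^ μ * x := by
      rw [Real.rpow_add_of_nonneg hx.1 hμ zero_le_one, Real.rpow_one]
    rw [h3, pow_succ]
    ring
  have hi1 := ((continuous_rpow_mul_one_sub_pow hμ N).const_mul (μ + 1)).intervalIntegrable
    (μ := MeasureTheory.volume) 0 1
  have hi2 := ((continuous_rpow_mul_one_sub_pow (μ := μ + 1) (by linarith) N).const_mul
    (μ + N + 2)).intervalIntegrable (μ := MeasureTheory.volume) 0 1
  have := intervalIntegral.integral_eq_sub_of_hasDerivAt hd (hi1.sub hi2)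
  rw [intervalIntegral.integral_sub hi1 hi2, intervalIntegral.integral_const_mul,
    intervalIntegral.integral_const_mul] at this
  rw [Real.zero_rpow (by linarith)] at this
  simp at this
  linarith

theorem integral_rpow_add_nat_mul_one_sub_pow_le {μ R : ℝ} (hμ : 0 ≤ μ) (N k : ℕ) (hR : 0 ≤ R)
    (h : ∀ i < k, μ + 1 + i ≤ R * (μ + N + 2 + i)) :
    ∫ r in (0 : ℝ)..1, r ^ (μ + k) * (1 - r) ^ N ≤
      R ^ k * ∫ r in (0 : ℝ)..1, r ^ μ * (1 - r) ^ N := by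
  induction k with
  | zero => simp
  | succ k ih =>
    have ih := ih fun i hi => h i (by omega)
    have h1 := integral_rpow_add_one_mul_one_sub_pow (μ := μ + k) (by positivity) N
    have h2 := h k (by omega)
    have hpos := integral_rpow_mul_one_sub_pow_pos (μ := μ + k) (by positivity) N
    have hc : (0 : ℝ) < μ + k + N + 2 := by positivity
    have e : μ + ((k + 1 : ℕ) : ℝ) = μ + k + 1 := by push_cast; ring
    rw [e]
    have h3 : (μ + k + N + 2) * ∫ r in (0 : ℝ)..1, r ^ (μ + k + 1) * (1 - r) ^ N ≤
        (μ + k + N + 2) * (R * ∫ r in (0 : ℝ)..1, r ^ (μ + k) * (1 - r) ^ N) := by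
      rw [h1, ← mul_assoc]
      gcongr
      linarith
    calc ∫ r in (0 : ℝ)..1, r ^ (μ + k + 1) * (1 - r) ^ N
        ≤ R * ∫ r in (0 : ℝ)..1, r ^ (μ + k) * (1 - r) ^ N := le_of_mul_le_mul_left h3 hc
      _ ≤ R * (R ^ k * ∫ r in (0 : ℝ)..1, r ^ μ * (1 - r) ^ N) := by gcongr
      _ = R ^ (k + 1) * ∫ r in (0 : ℝ)..1, r ^ μ * (1 - r) ^ N := by ring

/-- Markov's inequality for the k-th moment. With the preceding moment bound, the relative tail mass
is at most (R/a)^k. -/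
theorem integral_tail_rpow_mul_one_sub_pow_le {μ a : ℝ} (hμ : 0 ≤ μ) (N k : ℕ) (ha : 0 < a)
    (ha1 : a ≤ 1) :
    ∫ r in a..1, r ^ μ * (1 - r) ^ N ≤
      (a ^ k)⁻¹ * ∫ r in (0 : ℝ)..1, r ^ (μ + k) * (1 - r) ^ N := by
  have hc := continuous_rpow_mul_one_sub_pow (μ := μ + k) (by positivity) N
  have h1 : ∫ r in a..1, r ^ μ * (1 - r) ^ N ≤
      ∫ r in a..1, (a ^ k)⁻¹ * (r ^ (μ + k) * (1 - r) ^ N) := by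
    refine intervalIntegral.integral_mono_on ha1
      ((continuous_rpow_mul_one_sub_pow hμ N).intervalIntegrable _ _)
      ((hc.const_mul _).intervalIntegrable _ _) fun r hr => ?_
    have hr0 : 0 < r := ha.trans_le hr.1
    have hr1 : 0 ≤ 1 - r := by linarith [hr.2]
    rw [Real.rpow_add hr0, Real.rpow_natCast]
    have h2 : 1 ≤ (a ^ k)⁻¹ * r ^ k := by
      rw [← div_eq_inv_mul, one_le_div (by positivity)]
      exact pow_le_pow_left₀ ha.le hr.1 k
    have h3 : 0 ≤ r ^ μ * (1 - r) ^ N := by positivity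
    calc r ^ μ * (1 - r) ^ N ≤ ((a ^ k)⁻¹ * r ^ k) * (r ^ μ * (1 - r) ^ N) :=
          le_mul_of_one_le_left h3 h2
      _ = (a ^ k)⁻¹ * (r ^ μ * r ^ k * (1 - r) ^ N) := by ring
  refine h1.trans ?_
  rw [intervalIntegral.integral_const_mul]
  gcongr
  refine intervalIntegral.integral_mono_interval ha.le ha1 le_rfl ?_ (hc.intervalIntegrable _ _)
  refine (MeasureTheory.ae_restrict_iff' measurableSet_Ioc).mpr (Filter.Eventually.of_forall ?_)
  intro r hr
  have h2 := hr.1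
  have h3 : 0 ≤ 1 - r := by linarith [hr.2]
  simp only [Pi.zero_apply]
  positivity

theorem rpow_mul_integral_rpow_mul_one_sub_mul_pow {μ a : ℝ} (N : ℕ) (ha : 0 < a) :
    a ^ (μ + 1) * ∫ s in (0 : ℝ)..1, s ^ μ * (1 - a * s) ^ N =
      ∫ r in (0 : ℝ)..a, r ^ μ * (1 - r) ^ N := by
  have h := intervalIntegral.mul_integral_comp_mul_left (a := 0) (b := 1)
    (f := fun r : ℝ => r ^ μ * (1 - r) ^ N) a
  rw [mul_zero, mul_one] at h
  rw [← h, Real.rpow_add_one ha.ne', mul_comm (a ^ μ) a, mul_assoc,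
    ← intervalIntegral.integral_const_mul]
  congr 1
  refine intervalIntegral.integral_congr fun s hs => ?_
  rw [Set.uIcc_of_le zero_le_one] at hs
  rw [Real.mul_rpow ha.le hs.1]
  ring

theorem exists_polynomial_aeval_eq_integral {μ : ℝ} (hμ : 0 ≤ μ) (N : ℕ) :
    ∃ Q : ℝ[X], ∀ z : ℂ,
      aeval z Q = ∫ s in (0 : ℝ)..1, ((s ^ μ : ℝ) : ℂ) * (1 - z * s) ^ N := by
  refine ⟨∑ i ∈ range (N + 1), Polynomial.C ((-1) ^ i * (N.choose i : ℝ) *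
    ∫ s in (0 : ℝ)..1, s ^ μ * s ^ i) * X ^ i, fun z => ?_⟩
  have e : ∀ s : ℝ, ((s ^ μ : ℝ) : ℂ) * (1 - z * s) ^ N =
      ∑ i ∈ range (N + 1), ((-1) ^ i * (N.choose i : ℂ) * z ^ i) * ((s ^ μ * s ^ i : ℝ) : ℂ) := by
    intro s
    rw [sub_eq_neg_add, add_pow, mul_sum]
    refine sum_congr rfl fun i _ => ?_
    rw [one_pow, neg_pow (z * (s : ℂ)), mul_pow]
    push_cast
    ring
  simp only [e]
  have hc : ∀ i : ℕ, Continuous fun s : ℝ => ((s ^ μ * s ^ i : ℝ) : ℂ) := fun i =>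
    Complex.continuous_ofReal.comp ((Real.continuous_rpow_const hμ).mul (by fun_prop))
  rw [intervalIntegral.integral_finsetSum
    fun i _ => ((hc i).const_mul _).intervalIntegrable _ _, map_sum]
  refine sum_congr rfl fun i _ => ?_
  rw [intervalIntegral.integral_const_mul, intervalIntegral.integral_ofReal]
  simp
  ring

/-- Since 1 - zs = (1-s) + s(1-z), its norm is at most S - ‖z‖s. This reduces a complex z to the
real point ‖z‖/S. -/
theorem norm_integral_rpow_mul_one_sub_mul_pow_le {μ : ℝ} (hμ : 0 ≤ μ) (N : ℕ) {z : ℂ} {S : ℝ}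
    (hS : 1 ≤ S) (hz : ‖z‖ + ‖1 - z‖ ≤ S) :
    ‖∫ s in (0 : ℝ)..1, ((s ^ μ : ℝ) : ℂ) * (1 - z * s) ^ N‖ ≤
      S ^ N * ∫ s in (0 : ℝ)..1, s ^ μ * (1 - ‖z‖ / S * s) ^ N := by
  rw [← intervalIntegral.integral_const_mul]
  refine intervalIntegral.norm_integral_le_of_norm_le zero_le_one
    (Filter.Eventually.of_forall fun s hs => ?_)
    (((continuous_rpow_mul_one_sub_mul_pow hμ N _).const_mul _).intervalIntegrable _ _)
  have hs0 := hs.1.le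
  rw [norm_mul, norm_pow, Complex.norm_real, Real.norm_of_nonneg (by positivity), mul_left_comm,
    ← mul_pow]
  gcongr
  calc ‖1 - z * s‖ = ‖((1 - s : ℝ) : ℂ) + (s : ℂ) * (1 - z)‖ := by
        congr 1
        push_cast
        ring
    _ ≤ (1 - s) + s * ‖1 - z‖ := by
        refine (norm_add_le _ _).trans ?_
        rw [norm_mul, Complex.norm_real, Complex.norm_real, Real.norm_of_nonneg hs0,
          Real.norm_of_nonneg (by linarith [hs.2])]
    _ ≤ S - ‖z‖ * s := by nlinarith [hs.2]
    _ = S * (1 - ‖z‖ / S * s) := by field_simp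

/-- For fixed s > 0 the left side increases in a up to J/(s(J+N)), which is at least J/(J+N) ≥ b.
The proof bounds both ratios by t ≤ exp(t - 1) and adds the exponents. -/
theorem pow_mul_one_sub_mul_pow_le {a b s : ℝ} {J N : ℕ} (ha : 0 ≤ a) (hab : a ≤ b) (hb : b < 1)
    (hbJ : b * (J + N) ≤ J) (hs0 : 0 ≤ s) (hs1 : s ≤ 1) :
    a ^ J * (1 - a * s) ^ N ≤ b ^ J * (1 - b * s) ^ N := by
  rcases hab.eq_or_lt with rfl | hlt
  · rfl
  have hb0 : 0 < b := ha.trans_lt hlt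
  have hbs : 0 < 1 - b * s := by nlinarith
  have has : 0 ≤ 1 - a * s := by nlinarith
  have h1 : (a / b) ^ J ≤ Real.exp (J * (a / b - 1)) := by
    rw [Real.exp_nat_mul]
    gcongr
    linarith [Real.add_one_le_exp (a / b - 1)]
  have h2 : ((1 - a * s) / (1 - b * s)) ^ N ≤
      Real.exp (N * ((1 - a * s) / (1 - b * s) - 1)) := by
    rw [Real.exp_nat_mul]
    gcongr
    linarith [Real.add_one_le_exp ((1 - a * s) / (1 - b * s) - 1)]
  have h3 : J * (a / b - 1) + N * ((1 - a * s) / (1 - b * s) - 1) ≤ 0 := by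
    have : J * (a / b - 1) + N * ((1 - a * s) / (1 - b * s) - 1) =
        (b - a) * (b * s * (J + N) - J) / (b * (1 - b * s)) := by
      field_simp
      ring
    rw [this]
    refine div_nonpos_of_nonpos_of_nonneg ?_ (by positivity)
    refine mul_nonpos_of_nonneg_of_nonpos (by linarith) ?_
    nlinarith [mul_nonneg hb0.le (by positivity : (0 : ℝ) ≤ J + N)]
  have h4 : (a / b) ^ J * ((1 - a * s) / (1 - b * s)) ^ N ≤ 1 := by
    calc _ ≤ Real.exp (J * (a / b - 1)) * Real.exp (N * ((1 - a * s) / (1 - b * s) - 1)) := by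
          gcongr
      _ = Real.exp (J * (a / b - 1) + N * ((1 - a * s) / (1 - b * s) - 1)) :=
          (Real.exp_add _ _).symm
      _ ≤ 1 := Real.exp_le_one_iff.mpr h3
  rw [div_pow, div_pow, div_mul_div_comm, div_le_one (by positivity)] at h4
  exact h4

/-- The incomplete Beta function `a ^ (-γ) * I_a(γ + J, N + 1)` is a polynomial in `a`; it is
close to `a ^ (-γ)` away from the origin and bounded near the origin. -/
theorem exists_polynomial_approx_rpow_neg {γ b : ℝ} (hγ : 0 < γ) {J : ℕ} (hJ : 1 ≤ J) (N : ℕ)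
    (hb0 : 0 < b) (hb1 : b < 1) (hbJ : b * (J + N) ≤ J) :
    ∃ G : ℝ[X], (∀ a ∈ Set.Icc (0 : ℝ) 1, 0 ≤ G.eval a ∧ G.eval a ≤ b ^ (-γ)) ∧
      (∀ (z : ℂ) (S : ℝ), 1 ≤ S → ‖z‖ + ‖1 - z‖ ≤ S →
        ‖aeval z G‖ ≤ S ^ (J + N) * b ^ (-γ)) ∧
      (∀ a ∈ Set.Ioc (0 : ℝ) 1, G.eval a ≤ a ^ (-γ) ∧
        ∀ (k : ℕ) (R : ℝ), 0 ≤ R → (∀ i < k, γ + J + i ≤ R * (γ + J + N + 1 + i)) →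
          a ^ (-γ) * (1 - (R / a) ^ k) ≤ G.eval a) := by
  have hJ1 : (1 : ℝ) ≤ J := by exact_mod_cast hJ
  obtain ⟨μ, hμe⟩ : ∃ μ : ℝ, μ = γ + J - 1 := ⟨_, rfl⟩
  have hμ : 0 ≤ μ := by linarith
  obtain ⟨Q, hQ⟩ := exists_polynomial_aeval_eq_integral hμ N
  set β := ∫ r in (0 : ℝ)..1, r ^ μ * (1 - r) ^ N with hβ
  have hβ0 : 0 < β := integral_rpow_mul_one_sub_pow_pos hμ N
  let F : ℝ → ℝ := fun a => ∫ s in (0 : ℝ)..1, s ^ μ * (1 - a * s) ^ N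
  let G : ℝ[X] := Polynomial.C β⁻¹ * (X ^ J * Q)
  have hQr : ∀ a : ℝ, Q.eval a = F a := by
    intro a
    have h := hQ a
    have h1 : aeval (a : ℂ) Q = ((Q.eval a : ℝ) : ℂ) := by
      simpa using (aeval_algebraMap_apply (B := ℂ) a Q)
    have h2 : ∫ s in (0 : ℝ)..1, ((s ^ μ : ℝ) : ℂ) * (1 - (a : ℂ) * s) ^ N = ((F a : ℝ) : ℂ) := by
      simp only [F]
      rw [← intervalIntegral.integral_ofReal]
      push_cast
      rfl
    rw [h1, h2] at h
    exact_mod_cast h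
  have hG : ∀ a : ℝ, G.eval a = β⁻¹ * (a ^ J * F a) := by
    intro a
    simp [G, hQr]
  have hF0 : ∀ a ∈ Set.Icc (0 : ℝ) 1, 0 ≤ F a := by
    intro a ha
    refine intervalIntegral.integral_nonneg zero_le_one fun s hs => ?_
    have h1 : 0 ≤ 1 - a * s := by nlinarith [ha.1, ha.2, hs.1, hs.2]
    have := hs.1
    positivity
  have hG0 : ∀ a ∈ Set.Icc (0 : ℝ) 1, 0 ≤ G.eval a := by
    intro a ha
    rw [hG]
    have := hF0 a ha
    have := ha.1
    positivity
  have hinc : ∀ a ∈ Set.Ioc (0 : ℝ) 1,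
      G.eval a = a ^ (-γ) * (β⁻¹ * ∫ r in (0 : ℝ)..a, r ^ μ * (1 - r) ^ N) := by
    intro a ha
    rw [hG, ← rpow_mul_integral_rpow_mul_one_sub_mul_pow N ha.1]
    have : a ^ (μ + 1) = a ^ γ * a ^ J := by
      rw [← Real.rpow_natCast a J, ← Real.rpow_add ha.1, hμe]
      ring_nf
    rw [this, Real.rpow_neg ha.1.le]
    have : a ^ γ ≠ 0 := (Real.rpow_pos_of_pos ha.1 γ).ne'
    simp only [F]
    field_simp
  have hsplit : ∀ a : ℝ, (∫ r in (0 : ℝ)..a, r ^ μ * (1 - r) ^ N) +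
      ∫ r in a..1, r ^ μ * (1 - r) ^ N = β := fun a =>
    intervalIntegral.integral_add_adjacent_intervals
      ((continuous_rpow_mul_one_sub_pow hμ N).intervalIntegrable _ _)
      ((continuous_rpow_mul_one_sub_pow hμ N).intervalIntegrable _ _)
  have hle : ∀ a ∈ Set.Ioc (0 : ℝ) 1, G.eval a ≤ a ^ (-γ) := by
    intro a ha
    rw [hinc a ha]
    have h1 : 0 ≤ ∫ r in a..1, r ^ μ * (1 - r) ^ N := by
      refine intervalIntegral.integral_nonneg ha.2 fun s hs => ?_
      have h1 : 0 ≤ 1 - s := by linarith [hs.2]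
      have := ha.1.le.trans hs.1
      positivity
    have h2 : β⁻¹ * ∫ r in (0 : ℝ)..a, r ^ μ * (1 - r) ^ N ≤ 1 := by
      rw [inv_mul_le_one₀ hβ0]
      linarith [hsplit a]
    exact mul_le_of_le_one_right (Real.rpow_nonneg ha.1.le _) h2
  have hbd : ∀ a ∈ Set.Icc (0 : ℝ) 1, G.eval a ≤ b ^ (-γ) := by
    intro a ha
    -- Below b the integrand increases in a, so the value at b dominates; above b, a^(-γ) itself is
    -- at most b^(-γ).
    rcases le_total a b with hab | hab
    · refine le_trans ?_ (hle b ⟨hb0, hb1.le⟩)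
      rw [hG, hG]
      refine mul_le_mul_of_nonneg_left ?_ (inv_nonneg.mpr hβ0.le)
      simp only [F]
      rw [← intervalIntegral.integral_const_mul, ← intervalIntegral.integral_const_mul]
      refine intervalIntegral.integral_mono_on zero_le_one
        (((continuous_rpow_mul_one_sub_mul_pow hμ N _).const_mul _).intervalIntegrable _ _)
        (((continuous_rpow_mul_one_sub_mul_pow hμ N _).const_mul _).intervalIntegrable _ _)
        fun s hs => ?_
      have h1 := pow_mul_one_sub_mul_pow_le ha.1 hab hb1 hbJ hs.1 hs.2
      rw [mul_left_comm, mul_left_comm (b ^ J)]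
      exact mul_le_mul_of_nonneg_left h1 (Real.rpow_nonneg hs.1 _)
    · refine (hle a ⟨hb0.trans_le hab, ha.2⟩).trans ?_
      exact Real.rpow_le_rpow_of_nonpos hb0 hab (by linarith)
  refine ⟨G, fun a ha => ⟨hG0 a ha, hbd a ha⟩, fun z S hS hz => ?_, fun a ha => ⟨hle a ha, ?_⟩⟩
  · have hS0 : 0 < S := by linarith
    have hzS : ‖z‖ / S ∈ Set.Icc (0 : ℝ) 1 :=
      ⟨by positivity, by rw [div_le_one hS0]; linarith [norm_nonneg (1 - z)]⟩
    have h1 : ‖aeval z G‖ ≤ S ^ (J + N) * G.eval (‖z‖ / S) := by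
      have h2 : aeval z G = (β⁻¹ : ℝ) * (z ^ J * aeval z Q) := by simp [G]
      rw [h2, norm_mul, norm_mul, norm_pow, Complex.norm_real,
        Real.norm_of_nonneg (inv_nonneg.mpr hβ0.le), hQ, hG]
      calc β⁻¹ * (‖z‖ ^ J * ‖∫ s in (0 : ℝ)..1, ((s ^ μ : ℝ) : ℂ) * (1 - z * s) ^ N‖)
          ≤ β⁻¹ * (‖z‖ ^ J * (S ^ N * F (‖z‖ / S))) := by
            gcongr
            exact norm_integral_rpow_mul_one_sub_mul_pow_le hμ N hS hz
        _ = S ^ (J + N) * (β⁻¹ * ((‖z‖ / S) ^ J * F (‖z‖ / S))) := by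
            rw [div_pow, pow_add]
            field_simp
    exact h1.trans (mul_le_mul_of_nonneg_left (hbd _ hzS) (by positivity))
  · intro k R hR hk
    rw [hinc a ha]
    refine mul_le_mul_of_nonneg_left ?_ (Real.rpow_nonneg ha.1.le _)
    have h1 := integral_tail_rpow_mul_one_sub_pow_le hμ N k ha.1 ha.2
    have h2 := integral_rpow_add_nat_mul_one_sub_pow_le hμ N k hR
      (fun i hi => by have := hk i hi; rw [hμe]; convert this using 2 <;> ring)
    have h3 : ∫ r in a..1, r ^ μ * (1 - r) ^ N ≤ (a ^ k)⁻¹ * (R ^ k * β) :=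
      h1.trans (mul_le_mul_of_nonneg_left h2 (inv_nonneg.mpr (pow_nonneg ha.1.le k)))
    have h4 : (a ^ k)⁻¹ * (R ^ k * β) = (R / a) ^ k * β := by
      rw [div_pow]
      ring
    rw [← div_eq_inv_mul, le_div_iff₀ hβ0]
    linarith [hsplit a]

/-! ### Parameters and the high-degree approximant -/

/-- Parallelogram law for u and u⁻¹. Geometrically, the squared Joukowski map sends a circle to an
ellipse with foci 0 and 1. -/
theorem norm_joukowski_sq_add_norm_one_sub {u : ℂ} (hu : u ≠ 0) :
    ‖((u + u⁻¹) / 2) ^ 2‖ + ‖1 - ((u + u⁻¹) / 2) ^ 2‖ = (‖u‖ ^ 2 + (‖u‖ ^ 2)⁻¹) / 2 := by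
  have h1 : 1 - ((u + u⁻¹) / 2) ^ 2 = -((u - u⁻¹) / 2) ^ 2 := by
    field_simp
    ring
  have h2 := parallelogram_law_with_norm ℝ u u⁻¹
  rw [h1, norm_neg, norm_pow, norm_pow, norm_div, norm_div, Complex.norm_ofNat]
  rw [norm_inv] at h2
  rw [← inv_pow]
  linarith

/-- This fixes the margin η = 1/(2 max(1, c)): lowering the threshold from δ² to δ²(1-η) costs at
most a factor 2 in the sup bound. -/
theorem one_sub_inv_two_mul_rpow_ge (c : ℝ) :
    1 / 2 ≤ (1 - 1 / (2 * max 1 c)) ^ (c / 2) := by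
  set m := max 1 c with hm
  have hm1 : 1 ≤ m := le_max_left _ _
  have hcm : c ≤ m := le_max_right _ _
  have hη : 1 / (2 * m) ≤ 1 / 2 := by
    rw [div_le_div_iff₀ (by positivity) (by positivity)]
    linarith
  have hη0 : 0 < 1 / (2 * m) := by positivity
  rcases le_total 1 (c / 2) with h | h
  · have := one_add_mul_self_le_rpow_one_add (s := -(1 / (2 * m))) (by linarith) h
    rw [← sub_eq_add_neg] at this
    refine le_trans ?_ this
    have : c / 2 * (1 / (2 * m)) ≤ 1 / 4 := by
      rw [div_mul_div_comm, div_le_div_iff₀ (by positivity) (by positivity)]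
      linarith
    linarith
  · have h1 : (1 - 1 / (2 * m)) ^ (1 : ℝ) ≤ (1 - 1 / (2 * m)) ^ (c / 2) :=
      Real.rpow_le_rpow_of_exponent_ge (by linarith) (by linarith) h
    rw [Real.rpow_one] at h1
    linarith

theorem abs_div_rpow_eq {δ x : ℝ} (hδ : 0 < δ) (hx : 0 < x) (c : ℝ) :
    |δ / x| ^ c = (δ ^ 2) ^ (c / 2) * (x ^ 2) ^ (-(c / 2)) := by
  rw [abs_of_pos (by positivity), ← Real.rpow_natCast δ 2, ← Real.rpow_natCast x 2,
    ← Real.rpow_mul hδ.le, ← Real.rpow_mul hx.le, Real.div_rpow hδ.le hx.le, div_eq_mul_inv,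
    ← Real.rpow_neg hx.le]
  congr 2 <;> (push_cast; ring)

theorem abs_div_rpow_le_one {δ x c : ℝ} (hδ : 0 < δ) (hx : δ ≤ x) (hc : 0 < c) :
    |δ / x| ^ c ≤ 1 := by
  have hx0 := hδ.trans_le hx
  rw [abs_of_pos (by positivity)]
  exact Real.rpow_le_one (by positivity) ((div_le_one hx0).mpr hx) hc.le

theorem exists_incomplete_beta_parameters {δ ε c : ℝ} (hδ0 : 0 < δ) (hδ1 : δ < 1)
    (hε0 : 0 < ε) (hε1 : ε < 1) (hc : 0 < c) {η : ℝ} (hη : η = 1 / (2 * max 1 c)) :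
    ∃ J N k : ℕ, 1 ≤ J ∧ δ ^ 2 * (1 - η) * (J + N) ≤ J ∧ (1 - η / 2) ^ k ≤ ε ∧
      (∀ i < k, c / 2 + J + i ≤ δ ^ 2 * (1 - η / 2) * (c / 2 + J + N + 1 + i)) ∧
      (J + N : ℕ) * (2 * (δ / max 1 c) ^ 2) ≤ 64 * Real.log (1 / ε) + 28 := by
  set m := max 1 c with hm
  have hm1 : 1 ≤ m := le_max_left _ _
  have hcm : c ≤ m := le_max_right _ _
  have hm0 : 0 < m := by linarith
  clear_value m
  obtain ⟨Λ, hΛ⟩ : ∃ Λ, Λ = Real.log (1 / ε) := ⟨_, rfl⟩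
  have hΛ0 : 0 < Λ := hΛ ▸ Real.log_pos (by rw [lt_div_iff₀ hε0]; linarith)
  obtain ⟨γ, hγ⟩ : ∃ γ, γ = c / 2 := ⟨_, rfl⟩
  have hγ0 : 0 < γ := by linarith
  rw [← hγ, ← hΛ]
  have hη0 : 0 < η := by rw [hη]; positivity
  have hη2 : η ≤ 1 / 2 := by
    rw [hη, div_le_div_iff₀ (by positivity) (by positivity)]
    linarith
  obtain ⟨d, hd⟩ : ∃ d, d = δ ^ 2 := ⟨_, rfl⟩
  have hd0 : 0 < d := by rw [hd]; positivity
  have hd1 : d < 1 := by rw [hd]; nlinarith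
  rw [← hd]
  have hη1 : 0 < 1 - η := by linarith
  obtain ⟨b, hb⟩ : ∃ b, b = d * (1 - η) := ⟨_, rfl⟩
  have hb0 : 0 < b := by rw [hb]; positivity
  have hb1 : b < 1 := by rw [hb]; nlinarith
  -- As η/2 = 1/(4m), this k gives exp(-kη/2) ≤ ε, and the next J gives γ + k ≤ (η/2)J. Then J + N =
  -- ⌊J/b⌋ puts J/(J+N) just above b.
  obtain ⟨k, hk1, hk2⟩ : ∃ k : ℕ, 4 * m * Λ ≤ k ∧ (k : ℝ) ≤ 4 * m * Λ + 1 :=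
    ⟨_, Nat.le_ceil _, (Nat.ceil_lt_add_one (by positivity)).le⟩
  obtain ⟨J, hJ1, hJ2⟩ : ∃ J : ℕ, 4 * m * (γ + k) ≤ J ∧ (J : ℝ) ≤ 4 * m * (γ + k) + 1 :=
    ⟨_, Nat.le_ceil _, (Nat.ceil_lt_add_one (by positivity)).le⟩
  have hJ0 : (0 : ℝ) < J := lt_of_lt_of_le (by positivity) hJ1
  have hJpos : 1 ≤ J := by exact_mod_cast hJ0
  have hJK : J ≤ ⌊J / b⌋₊ := Nat.le_floor (by rw [le_div_iff₀ hb0]; nlinarith)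
  obtain ⟨N, hN⟩ : ∃ N, ⌊J / b⌋₊ = J + N := Nat.exists_eq_add_of_le hJK
  have hK1 : (J + N : ℝ) ≤ J / b := by
    have := Nat.floor_le (show 0 ≤ J / b by positivity)
    rw [hN] at this
    exact_mod_cast this
  have hK2 : J / b < J + N + 1 := by
    have := Nat.lt_floor_add_one (J / b)
    rw [hN] at this
    exact_mod_cast this
  refine ⟨J, N, k, hJpos, ?_, ?_, fun i hi => ?_, ?_⟩
  · rw [← hb, mul_comm]
    exact (le_div_iff₀ hb0).mp hK1
  · have h1 : 1 - η / 2 ≤ Real.exp (-(η / 2)) := by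
      linarith [Real.add_one_le_exp (-(η / 2))]
    calc (1 - η / 2) ^ k ≤ Real.exp (-(η / 2)) ^ k := pow_le_pow_left₀ (by linarith) h1 k
      _ = Real.exp (k * -(η / 2)) := (Real.exp_nat_mul _ _).symm
      _ ≤ Real.exp (-Λ) := by
        refine Real.exp_le_exp.mpr ?_
        have h2 : η / 2 * (4 * m * Λ) = Λ := by rw [hη]; field_simp; norm_num
        have h3 := mul_le_mul_of_nonneg_left hk1 (by positivity : 0 ≤ η / 2)
        linarith
      _ = ε := by rw [hΛ, one_div, Real.log_inv, neg_neg, Real.exp_log hε0]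
  · have hik : (i : ℝ) ≤ k := by exact_mod_cast hi.le
    have hγk : γ + k ≤ η / 2 * J := by
      have h4 : η / 2 * (4 * m * (γ + k)) = γ + k := by rw [hη]; field_simp; norm_num
      have h5 := mul_le_mul_of_nonneg_left hJ1 (by positivity : 0 ≤ η / 2)
      linarith
    have h7 : J ≤ (J + N + 1) * (d * (1 - η)) := by
      rw [← hb]
      exact ((div_lt_iff₀ hb0).mp hK2).le
    have hi0 : (0 : ℝ) ≤ i := by positivity
    have hη4 : 0 < 1 - η / 2 := by linarith
    calc γ + J + i ≤ (1 + η / 2) * J := by linarith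
      _ ≤ (1 + η / 2) * ((J + N + 1) * (d * (1 - η))) := by gcongr
      _ = (J + N + 1) * d * ((1 + η / 2) * (1 - η)) := by ring
      -- (1 + η/2)(1 - η) ≤ 1 - η/2: half of the margin pays for γ + i, the other half remains for
      -- decay.
      _ ≤ (J + N + 1) * d * (1 - η / 2) := by
        gcongr
        nlinarith
      _ = d * (1 - η / 2) * (J + N + 1) := by ring
      _ ≤ d * (1 - η / 2) * (γ + J + N + 1 + i) :=
        mul_le_mul_of_nonneg_left (by linarith) (by positivity)
  · have h2 : ((J + N : ℕ) : ℝ) ≤ 2 * J / d := by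
      push_cast
      refine hK1.trans ?_
      rw [div_le_div_iff₀ hb0 hd0, hb]
      nlinarith [mul_pos hJ0 hd0]
    have h3 : (J : ℝ) ≤ m ^ 2 * (16 * Λ + 7) := by
      have h4 : 4 * m * (γ + k) ≤ 4 * m * (m / 2 + (4 * m * Λ + m)) := by
        gcongr <;> linarith
      nlinarith
    calc (J + N : ℕ) * (2 * (δ / m) ^ 2) ≤ 2 * J / d * (2 * (δ / m) ^ 2) := by gcongr
      _ = 4 * J / m ^ 2 := by
        rw [hd]
        field_simp
        norm_num
      _ ≤ 4 * (m ^ 2 * (16 * Λ + 7)) / m ^ 2 := by gcongr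
      _ = 64 * Λ + 28 := by
        field_simp
        ring

/-- A polynomial approximation of `(δ / x) ^ c` of possibly large degree, but with control of its
size on a complex neighbourhood of `[-1, 1]`. -/
theorem exists_polynomial_approx_with_joukowski_bound {δ ε c : ℝ} (hδ0 : 0 < δ) (hδ1 : δ < 1)
    (hε0 : 0 < ε) (hε1 : ε < 1) (hc : 0 < c) :
    ∃ P : ℝ[X], Function.Even (fun x : ℝ => P.eval x) ∧
      (∀ x ∈ Set.Icc (-1 : ℝ) 1, |P.eval x| ≤ 2) ∧
      (∀ x ∈ Set.Icc δ 1, |P.eval x - |δ / x| ^ c| ≤ ε) ∧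
      ∀ u : ℂ, ‖u‖ = Real.exp (-(δ / max 1 c)) →
        ‖aeval ((u + u⁻¹) / 2) P‖ ≤ 2 * Real.exp (64 * Real.log (1 / ε) + 28) := by
  obtain ⟨η, hη⟩ : ∃ η, η = 1 / (2 * max 1 c) := ⟨_, rfl⟩
  have hγ0 : 0 < c / 2 := by linarith
  have hη0 : 0 < η := by rw [hη]; positivity
  have hη2 : η ≤ 1 / 2 := by
    rw [hη, div_le_div_iff₀ (by positivity) (by positivity)]
    linarith [le_max_left 1 c]
  have hη1 : 0 < 1 - η := by linarith
  have hη3 : 0 < 1 - η / 2 := by linarith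
  have hd0 : 0 < δ ^ 2 := by positivity
  have hd1 : δ ^ 2 < 1 := by nlinarith
  obtain ⟨J, N, k, hJ, hbJ, hkε, hk, hJN⟩ :=
    exists_incomplete_beta_parameters hδ0 hδ1 hε0 hε1 hc hη
  obtain ⟨G, hG1, hG2, hG3⟩ := exists_polynomial_approx_rpow_neg hγ0 hJ N (by positivity)
    (by nlinarith) hbJ
  have hdb : (δ ^ 2) ^ (c / 2) * (δ ^ 2 * (1 - η)) ^ (-(c / 2)) ≤ 2 := by
    rw [Real.mul_rpow hd0.le hη1.le, ← mul_assoc, ← Real.rpow_add hd0, add_neg_cancel,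
      Real.rpow_zero, one_mul, Real.rpow_neg hη1.le, hη]
    simpa using inv_anti₀ (by norm_num) (one_sub_inv_two_mul_rpow_ge c)
  have hdγ : 0 < (δ ^ 2) ^ (c / 2) := Real.rpow_pos_of_pos hd0 _
  let P : ℝ[X] := Polynomial.C ((δ ^ 2) ^ (c / 2)) * G.comp (X ^ 2)
  have hP : ∀ x : ℝ, P.eval x = (δ ^ 2) ^ (c / 2) * G.eval (x ^ 2) := fun x => by simp [P]
  have hPc : ∀ z : ℂ, aeval z P = (((δ ^ 2) ^ (c / 2) : ℝ) : ℂ) * aeval (z ^ 2) G := fun z => by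
    simp only [P, map_mul, aeval_C, aeval_comp, map_pow, aeval_X, Complex.coe_algebraMap]
  clear_value P
  refine ⟨P, fun x => by simp [hP], fun x hx => ?_, fun x hx => ?_, fun u hu => ?_⟩
  · have hx2 : x ^ 2 ∈ Set.Icc (0 : ℝ) 1 := ⟨sq_nonneg x, by nlinarith [hx.1, hx.2]⟩
    obtain ⟨h1, h2⟩ := hG1 _ hx2
    rw [hP, abs_of_nonneg (mul_nonneg hdγ.le h1)]
    exact (mul_le_mul_of_nonneg_left h2 hdγ.le).trans hdb
  · have hx0 : 0 < x := hδ0.trans_le hx.1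
    have hxd : δ ^ 2 ≤ x ^ 2 := pow_le_pow_left₀ hδ0.le hx.1 2
    have hx2 : x ^ 2 ∈ Set.Ioc (0 : ℝ) 1 := ⟨by positivity, by nlinarith [hx.2]⟩
    obtain ⟨h1, h2⟩ := hG3 _ hx2
    have h3 := h2 k (δ ^ 2 * (1 - η / 2)) (by positivity) hk
    have hf := abs_div_rpow_eq hδ0 hx0 c
    have hf1 := hf ▸ abs_div_rpow_le_one hδ0 hx.1 hc
    have hf0 : 0 ≤ (δ ^ 2) ^ (c / 2) * (x ^ 2) ^ (-(c / 2)) :=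
      mul_nonneg hdγ.le (Real.rpow_nonneg hx2.1.le _)
    have hR0 : 0 ≤ δ ^ 2 * (1 - η / 2) / x ^ 2 := by positivity
    have hRε : (δ ^ 2 * (1 - η / 2) / x ^ 2) ^ k ≤ ε := by
      refine (pow_le_pow_left₀ hR0 ?_ k).trans hkε
      rw [div_le_iff₀ hx2.1, mul_comm]
      exact mul_le_mul_of_nonneg_left hxd hη3.le
    have h4 := mul_le_mul_of_nonneg_left h3 hdγ.le
    have h5 := mul_le_mul hf1 hRε (pow_nonneg hR0 k) zero_le_one
    have h6 := mul_le_mul_of_nonneg_left h1 hdγ.le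
    rw [hf, hP, abs_le]
    constructor <;> linarith
  · have hu0 : u ≠ 0 := by
      rw [← norm_pos_iff, hu]
      exact Real.exp_pos _
    obtain ⟨w, hw⟩ : ∃ w, w = δ / max 1 c := ⟨_, rfl⟩
    rw [← hw] at hu hJN
    obtain ⟨S, hS⟩ : ∃ S, S = (‖u‖ ^ 2 + (‖u‖ ^ 2)⁻¹) / 2 := ⟨_, rfl⟩
    have hScosh : S = Real.cosh (2 * w) := by
      rw [hS, hu, Real.cosh_eq, ← Real.exp_nat_mul, ← Real.exp_neg, add_comm (Real.exp (2 * w))]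
      congr 3 <;> (push_cast; ring)
    have hS1 : 1 ≤ S := hScosh ▸ Real.one_le_cosh _
    have hSe : S ≤ Real.exp (2 * w ^ 2) := by
      rw [hScosh]
      refine (Real.cosh_le_exp_half_sq _).trans (Real.exp_le_exp.mpr ?_)
      linarith
    have h1 := hG2 _ S hS1 ((norm_joukowski_sq_add_norm_one_sub hu0).trans hS.symm).le
    have hSpow : S ^ (J + N) ≤ Real.exp (64 * Real.log (1 / ε) + 28) := by
      calc S ^ (J + N) ≤ Real.exp (2 * w ^ 2) ^ (J + N) :=
            pow_le_pow_left₀ (by linarith) hSe _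
        _ = Real.exp ((J + N : ℕ) * (2 * w ^ 2)) := (Real.exp_nat_mul _ _).symm
        _ ≤ _ := Real.exp_le_exp.mpr hJN
    rw [hPc, norm_mul, Complex.norm_real, Real.norm_of_nonneg hdγ.le]
    calc (δ ^ 2) ^ (c / 2) * ‖aeval (((u + u⁻¹) / 2) ^ 2) G‖
        ≤ (δ ^ 2) ^ (c / 2) * (S ^ (J + N) * (δ ^ 2 * (1 - η)) ^ (-(c / 2))) :=
          mul_le_mul_of_nonneg_left h1 hdγ.le
      _ = (δ ^ 2) ^ (c / 2) * (δ ^ 2 * (1 - η)) ^ (-(c / 2)) * S ^ (J + N) := by ring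
      _ ≤ 2 * Real.exp (64 * Real.log (1 / ε) + 28) :=
          mul_le_mul hdb hSpow (by positivity) (by norm_num)

/-! ### Even and odd approximants of the required degree -/

theorem exists_even_polynomial_approx {δ ε c : ℝ} (hδ0 : 0 < δ) (hδ1 : δ < 1)
    (hε0 : 0 < ε) (hε1 : ε < 1) (hc : 0 < c) :
    ∃ p : ℝ[X], Function.Even (fun x : ℝ => p.eval x) ∧
      (p.natDegree : ℝ) ≤ 192 * (max 1 c / δ * (1 + Real.log (1 / ε))) ∧
      (∀ x ∈ Set.Icc (-1 : ℝ) 1, |p.eval x| ≤ 3) ∧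
      (∀ x ∈ Set.Icc δ 1, |p.eval x - |δ / x| ^ c| ≤ ε) := by
  obtain ⟨P, hPe, hP2, hPf, hPu⟩ := exists_polynomial_approx_with_joukowski_bound hδ0 hδ1
    (half_pos hε0) (by linarith) hc
  set m := max 1 c with hm
  have hm1 : 1 ≤ m := le_max_left _ _
  have hm0 : 0 < m := by linarith
  set Λ := Real.log (1 / (ε / 2)) with hΛ
  have hΛ0 : 0 < Λ := Real.log_pos (by rw [lt_div_iff₀ (by linarith)]; linarith)
  have hΛε : Real.exp (-Λ) = ε / 2 := by
    rw [hΛ, one_div, Real.log_inv, neg_neg, Real.exp_log (by linarith)]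
  have hΛ1 : Λ ≤ 1 + Real.log (1 / ε) := by
    have : 1 / (ε / 2) = 2 * (1 / ε) := by field_simp
    rw [hΛ, this, Real.log_mul (by norm_num) (by positivity)]
    linarith [Real.log_two_lt_d9]
  have hLε : 0 < Real.log (1 / ε) := Real.log_pos (by rw [lt_div_iff₀ hε0]; linarith)
  set w := δ / m with hw
  have hw0 : 0 < w := by positivity
  have hw1 : w ≤ 1 := by
    rw [hw, div_le_one hm0]
    linarith
  -- 64Λ + 28 cancels the growth bound, the extra Λ yields ε/2, and the extra 2 absorbs the
  -- numerical factors.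
  set n := ⌈(65 * Λ + 30) / w⌉₊ with hn
  have hn1 : (65 * Λ + 30) / w ≤ n := Nat.le_ceil _
  have hn2 : (n : ℝ) ≤ (65 * Λ + 30) / w + 1 := (Nat.ceil_lt_add_one (by positivity)).le
  have hnpos : 1 ≤ n := Nat.one_le_iff_ne_zero.mpr (Nat.ceil_pos.mpr (by positivity)).ne'
  have hnw : 65 * Λ + 30 ≤ n * w := (div_le_iff₀ hw0).mp hn1
  obtain ⟨q, hqd, hq⟩ := P.exists_natDegree_le_approx_of_joukowski_bound (Real.exp_pos (-w))
    (by simpa using hw0) (by positivity) hPu hnpos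
  have herr : ∀ x ∈ Set.Icc (-1 : ℝ) 1, |P.eval x - q.eval x| ≤ ε / 2 := by
    intro x hx
    refine (hq x hx).trans ?_
    rw [← Real.exp_nat_mul, ← Real.exp_nat_mul]
    have h1 : 2 * w / 3 ≤ 1 - Real.exp ((2 : ℕ) * -w) := by
      have h2 : Real.exp ((2 : ℕ) * -w) ≤ 1 / (1 + 2 * w) := by
        rw [show ((2 : ℕ) : ℝ) * -w = -(2 * w) by push_cast; ring, Real.exp_neg, ← one_div]
        refine one_div_le_one_div_of_le (by positivity) ?_
        linarith [Real.add_one_le_exp (2 * w)]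
      have h3 : 1 / (1 + 2 * w) ≤ 1 - 2 * w / 3 := by
        rw [div_le_iff₀ (by positivity)]
        nlinarith
      linarith
    have h4 : 2 / 3 ≤ n * (1 - Real.exp ((2 : ℕ) * -w)) := by
      have h5 : (n : ℝ) * (2 * w / 3) ≤ n * (1 - Real.exp ((2 : ℕ) * -w)) := by gcongr
      nlinarith
    have h6 : Real.exp (64 * Λ + 28) * Real.exp (n * -w) ≤ 1 / 6 * (ε / 2) := by
      rw [← Real.exp_add, ← hΛε]
      have h7 : Real.exp (-2) ≤ 1 / 6 := by
        have h8 : (6 : ℝ) ≤ Real.exp 2 := by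
          have h9 := Real.exp_one_gt_d9
          have : Real.exp 2 = Real.exp 1 * Real.exp 1 := by rw [← Real.exp_add]; norm_num
          nlinarith
        rw [Real.exp_neg, ← one_div]
        exact one_div_le_one_div_of_le (by norm_num) h8
      calc Real.exp (64 * Λ + 28 + n * -w) ≤ Real.exp (-2 + -Λ) :=
            Real.exp_le_exp.mpr (by linarith)
        _ = Real.exp (-2) * Real.exp (-Λ) := Real.exp_add _ _
        _ ≤ _ := by gcongr
    rw [div_le_iff₀ (lt_of_lt_of_le (by norm_num) h4)]
    calc 2 * (2 * Real.exp (64 * Λ + 28)) * Real.exp (n * -w)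
        = 4 * (Real.exp (64 * Λ + 28) * Real.exp (n * -w)) := by ring
      _ ≤ 4 * (1 / 6 * (ε / 2)) := by gcongr
      _ = ε / 2 * (2 / 3) := by ring
      _ ≤ ε / 2 * (n * (1 - Real.exp ((2 : ℕ) * -w))) := by gcongr
  -- The even part of q; as P is even, the error does not grow.
  let p : ℝ[X] := Polynomial.C (1 / 2) * (q + q.comp (-X))
  have hp : ∀ x : ℝ, p.eval x = (q.eval x + q.eval (-x)) / 2 := by
    intro x
    simp [p]
    ring
  have hpP : ∀ x ∈ Set.Icc (-1 : ℝ) 1, |p.eval x - P.eval x| ≤ ε / 2 := by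
    intro x hx
    have h1 := abs_le.mp (herr x hx)
    have h2 := abs_le.mp (herr (-x) ⟨by linarith [hx.2], by linarith [hx.1]⟩)
    have h3 : P.eval (-x) = P.eval x := hPe x
    rw [h3] at h2
    rw [hp, abs_le]
    constructor <;> linarith [h1.1, h1.2, h2.1, h2.2]
  refine ⟨p, fun x => ?_, ?_, fun x hx => ?_, fun x hx => ?_⟩
  · simp only [hp, neg_neg, add_comm]
  · have h1 : p.natDegree ≤ 2 * n := by
      refine (natDegree_C_mul_le _ _).trans ((natDegree_add_le _ _).trans (max_le hqd ?_))
      rw [natDegree_comp, natDegree_neg, natDegree_X, mul_one]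
      exact hqd
    have h2 : (p.natDegree : ℝ) ≤ 2 * n := by exact_mod_cast h1
    have h3 : 1 ≤ m / δ := by
      rw [one_le_div hδ0]
      linarith
    have h4 : (65 * Λ + 30) / w = (65 * Λ + 30) * (m / δ) := by
      rw [hw]
      field_simp
    rw [h4] at hn2
    nlinarith
  · have h1 := abs_le.mp (hpP x hx)
    have h2 := abs_le.mp (hP2 x hx)
    rw [abs_le]
    constructor <;> linarith [h1.1, h1.2, h2.1, h2.2]
  · have h1 := abs_le.mp (hpP x ⟨by linarith [hx.1], hx.2⟩)
    have h2 := abs_le.mp (hPf x hx)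
    rw [abs_le]
    constructor <;> linarith [h1.1, h1.2, h2.1, h2.2]

theorem exists_odd_polynomial_approx {δ ε c : ℝ} (hδ0 : 0 < δ) (hδ1 : δ < 1)
    (hε0 : 0 < ε) (hε1 : ε < 1) (hc : 0 < c) :
    ∃ q : ℝ[X], Function.Odd (fun x : ℝ => q.eval x) ∧
      (q.natDegree : ℝ) ≤ 1 + 192 * (max 1 (c + 1) / δ * (1 + Real.log (1 / (δ * ε)))) ∧
      (∀ x ∈ Set.Icc (-1 : ℝ) 1, |q.eval x| ≤ 3) ∧
      (∀ x ∈ Set.Icc δ 1, |q.eval x - |δ / x| ^ c| ≤ ε) := by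
  obtain ⟨p, hpe, hpd, hp3, hpf⟩ := exists_even_polynomial_approx hδ0 hδ1
    (ε := δ * ε) (by positivity) (by nlinarith) (show 0 < c + 1 by linarith)
  let q : ℝ[X] := Polynomial.C δ⁻¹ * (p * X)
  have hq : ∀ x : ℝ, q.eval x = x / δ * p.eval x := by
    intro x
    simp [q]
    ring
  have hqodd : ∀ x : ℝ, q.eval (-x) = -q.eval x := by
    intro x
    have h : p.eval (-x) = p.eval x := hpe x
    rw [hq, hq, h]
    ring
  have hqf : ∀ x ∈ Set.Icc δ 1, |q.eval x - |δ / x| ^ c| ≤ ε := by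
    intro x hx
    have hx0 : 0 < x := hδ0.trans_le hx.1
    have h1 : |δ / x| ^ c = x / δ * |δ / x| ^ (c + 1) := by
      have : 0 < |δ / x| := abs_pos.mpr (by positivity)
      rw [Real.rpow_add_one this.ne', abs_of_pos (by positivity : 0 < δ / x)]
      field_simp
    rw [hq, h1, ← mul_sub, abs_mul, abs_of_pos (by positivity : 0 < x / δ)]
    calc x / δ * |p.eval x - |δ / x| ^ (c + 1)| ≤ 1 / δ * (δ * ε) := by
          gcongr
          · exact hx.2
          · exact hpf x hx
      _ = ε := by field_simp
  have hq3 : ∀ x ∈ Set.Icc (0 : ℝ) 1, |q.eval x| ≤ 3 := by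
    intro x hx
    -- For x ≤ δ the factor x/δ is at most 1 and the bound for p carries over; for x ≥ δ, q is
    -- within ε of a function bounded by 1.
    rcases le_total x δ with h | h
    · have h1 : x / δ ≤ 1 := (div_le_one hδ0).mpr h
      have h2 : 0 ≤ x / δ := div_nonneg hx.1 hδ0.le
      rw [hq, abs_mul, abs_of_nonneg h2]
      exact (mul_le_of_le_one_left (abs_nonneg _) h1).trans
        (hp3 x ⟨by linarith [hx.1], hx.2⟩)
    · have h1 := abs_le.mp (hqf x ⟨h, hx.2⟩)
      have h2 := abs_div_rpow_le_one hδ0 h hc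
      have h3 : 0 ≤ |δ / x| ^ c := by positivity
      rw [abs_le]
      constructor <;> linarith [h1.1, h1.2]
  refine ⟨q, hqodd, ?_, fun x hx => ?_, hqf⟩
  · have h1 : q.natDegree ≤ p.natDegree + 1 :=
      (natDegree_C_mul_le _ _).trans (natDegree_mul_le.trans (by rw [natDegree_X]))
    have h2 : (q.natDegree : ℝ) ≤ p.natDegree + 1 := by exact_mod_cast h1
    linarith
  · rcases le_total 0 x with h | h
    · exact hq3 x ⟨h, hx.2⟩
    · rw [← abs_neg, ← hqodd]
      exact hq3 (-x) ⟨by linarith, by linarith [hx.1]⟩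

theorem corollary3p8 :
    ∃ C : ℝ, 0 < C ∧ ∀ δ ε c : ℝ, δ ∈ Set.Ioo (0 : ℝ) 1 → ε ∈ Set.Ioo (0 : ℝ) 1 → 0 < c →
      (∃ p : Polynomial ℝ,
        Function.Even (fun x : ℝ => p.eval x) ∧
        (p.natDegree : ℝ) ≤ C * (max 1 c / δ * Real.log (1 / (δ * ε))) ∧
        (∀ x ∈ Set.Icc (-1 : ℝ) 1, |p.eval x| ≤ 3) ∧
        (∀ x ∈ Set.Icc δ 1, |p.eval x - |δ / x| ^ c| ≤ ε)) ∧
      (∃ p : Polynomial ℝ,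
        Function.Odd (fun x : ℝ => p.eval x) ∧
        (p.natDegree : ℝ) ≤ max 1 (C * (max 1 c / δ * Real.log (1 / (δ * ε)))) ∧
        (∀ x ∈ Set.Icc (-1 : ℝ) 1, |p.eval x| ≤ 3) ∧
        (∀ x ∈ Set.Icc δ 1, |p.eval x - |δ / x| ^ c| ≤ ε)) := by
  refine ⟨2000, by norm_num, fun δ ε c ⟨hδ0, hδ1⟩ ⟨hε0, hε1⟩ hc => ?_⟩
  have hδε : 0 < δ * ε := mul_pos hδ0 hε0
  have hδε1 : δ * ε < 1 := by nlinarith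
  obtain ⟨L, hL⟩ : ∃ L, L = Real.log (1 / (δ * ε)) := ⟨_, rfl⟩
  have hL0 : 0 < L := hL ▸ Real.log_pos (by rw [lt_div_iff₀ hδε]; linarith)
  have hD0 : 0 < max 1 c / δ := div_pos (lt_max_of_lt_left one_pos) hδ0
  rw [← hL]
  -- The logarithm can be arbitrarily small when δε is near 1. There both δ and ε exceed 1/2, and
  -- the polynomials 1/2 and εx suffice; the latter is why the odd degree bound has max(1, ·).
  rcases le_total (1 / 2) (δ * ε) with h | h
  · have hf : ∀ x ∈ Set.Icc δ 1, 0 ≤ |δ / x| ^ c ∧ |δ / x| ^ c ≤ 1 := fun x hx =>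
      ⟨by positivity, abs_div_rpow_le_one hδ0 hx.1 hc⟩
    refine ⟨⟨Polynomial.C (1 / 2), fun x => by simp, ?_, fun x _ => ?_, fun x hx => ?_⟩,
      ⟨Polynomial.C ε * X, fun x => by simp, ?_, fun x hx => ?_, fun x hx => ?_⟩⟩
    · rw [natDegree_C, Nat.cast_zero]
      positivity
    · rw [eval_C]
      norm_num [abs_le]
    · obtain ⟨h1, h2⟩ := hf x hx
      rw [eval_C, abs_le]
      constructor <;> nlinarith
    · refine le_max_of_le_left ?_
      have : (Polynomial.C ε * X : ℝ[X]).natDegree ≤ 1 :=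
        (natDegree_C_mul_le _ _).trans natDegree_X_le
      exact_mod_cast this
    · rw [eval_mul, eval_C, eval_X, abs_le]
      constructor <;> nlinarith [hx.1, hx.2]
    · obtain ⟨h1, h2⟩ := hf x hx
      rw [eval_mul, eval_C, eval_X, abs_le]
      constructor <;> nlinarith [hx.1, hx.2]
  · have hL2 : 1 / 2 ≤ L := by
      have h1 : Real.log 2 ≤ L := by
        rw [hL]
        refine Real.log_le_log (by norm_num) ?_
        rw [le_div_iff₀ hδε]
        linarith
      linarith [Real.log_two_gt_d9]
    have hεL : Real.log (1 / ε) ≤ L := by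
      rw [hL]
      refine Real.log_le_log (by positivity) (one_div_le_one_div_of_le hδε ?_)
      nlinarith
    have hDL : 1 / 2 ≤ max 1 c / δ * L := by
      have h1 : 1 ≤ max 1 c / δ := by
        rw [one_le_div hδ0]
        linarith [le_max_left 1 c]
      nlinarith
    obtain ⟨p, hp1, hp2, hp3, hp4⟩ := exists_even_polynomial_approx hδ0 hδ1 hε0 hε1 hc
    obtain ⟨q, hq1, hq2, hq3, hq4⟩ := exists_odd_polynomial_approx hδ0 hδ1 hε0 hε1 hc
    rw [← hL] at hq2
    refine ⟨⟨p, hp1, ?_, hp3, hp4⟩, ⟨q, hq1, le_max_of_le_right ?_, hq3, hq4⟩⟩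
    · have h1 : max 1 c / δ * (1 + Real.log (1 / ε)) ≤ max 1 c / δ * (3 * L) :=
        mul_le_mul_of_nonneg_left (by linarith) hD0.le
      linarith
    · have h1 : max 1 (c + 1) / δ ≤ 2 * (max 1 c / δ) := by
        rw [← mul_div_assoc]
        refine div_le_div_of_nonneg_right (max_le ?_ ?_) hδ0.le <;>
          linarith [le_max_left 1 c, le_max_right 1 c]
      have h2 : max 1 (c + 1) / δ * (1 + L) ≤ 2 * (max 1 c / δ) * (3 * L) :=
        mul_le_mul h1 (by linarith) (by linarith) (by linarith)
      linarith
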